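/- Let $G$ be a finite simple graph with chromatic number $\chi(G)$, let $H$ be any subgraph of the complement $\overline{G}$, and let $k$ be an integer with $k\ge\chi(G)$. Let $m(G,H,k)$ denote the minimum, over all proper colorings of $G$ with $k$ colors, of the number of monochromatic edges of $H$, that is, of edges of $H$ whose two endpoints receive the same color. Then: 1. If $G$ is a tree and $k\ge 2$, then $m(G,H,k)\le \dfrac{|E(H)|}{k-1}$. 2. If $G$ is series-parallel and $\chi(G)=3$, then $m(G,H,k)\le \dfrac{|E(H)|}{k-2}$. 3. If $G$ is bipartite and outerplanar, and $k>2$, then $m(G,H,k)\le \dfrac{|E(H)|}{k-2}$. 4. If $G$ is an $\ell$-tree with $\chi(G)=\ell+1$, then $m(G,H,k)\le \dfrac{|E(H)|}{k-\ell}$. Here a simple graph is *series-parallel* if it can be turned into $K_2$ by a sequence of the following two operations on multigraphs: identifying a vertex $v$ of degree two with one of its neighbors (so that the two edges $va$, $vb$ at $v$ are replaced by one edge $ab$), and deleting one of two parallel edges. A graph is *outerplanar* if it can be drawn without crossings in a closed disc with all its vertices on the boundary circle. An *$\ell$-tree* is a graph obtained from a complete graph on $\ell+1$ vertices by repeatedly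 adding a vertex that has exactly $\ell$ neighbors among the vertices already present, these $\ell$ neighbors and the new vertex forming a clique. -/

import Mathlib

namespace RobustColoring

/-- The number of edges of a subgraph `H` of the complement of `G` whose two endpoints receive the
same color under the proper coloring `φ` of `G`. -/
noncomputable def monochromaticCount {V : Type*} {G : SimpleGraph V} {k : ℕ}
    (H : Gᶜ.Subgraph) (φ : G.Coloring (Fin k)) : ℕ :=
  {e : Sym2 V | e ∈ H.edgeSet ∧ (e.map φ).IsDiag}.ncard

/-- `m(G, H, k)`: the minimum, over all proper colorings of `G` with `k` colors, of the number of
monochromatic edges of `H`. (Only meaningful when `k` is at least the chromatic number of `G`, so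
that such colorings exist.) -/
noncomputable def robustNumber {V : Type*} (G : SimpleGraph V) (H : Gᶜ.Subgraph) (k : ℕ) : ℕ :=
  sInf (Set.range fun φ : G.Coloring (Fin k) => monochromaticCount H φ)

/-- `ReducesToK2 S E`: the multigraph with vertex set `S` and multiset of edges `E` can be turned
into `K₂` by a sequence of series and parallel reductions.
* `parallel`: one of two parallel edges may be deleted.
* `series`: a vertex `v` of degree two, with incident edges `va` and `vb`, may be identified with
  one of its neighbors, so that the two edges `va`, `vb` are replaced by the single edge `ab`. -/
inductive ReducesToK2 {V : Type*} : Finset V → Multiset (Sym2 V) → Prop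
  | base (a b : V) (hab : a ∉ ({b} : Finset V)) :
      ReducesToK2 (Finset.cons a {b} hab) {s(a, b)}
  | parallel (S : Finset V) (e : Sym2 V) (E : Multiset (Sym2 V)) :
      ReducesToK2 S (e ::ₘ E) → ReducesToK2 S (e ::ₘ e ::ₘ E)
  | series (S : Finset V) (v a b : V) (E : Multiset (Sym2 V)) (hv : v ∉ S) :
      a ∈ S → b ∈ S → (∀ e ∈ E, v ∉ e) →
      ReducesToK2 S (s(a, b) ::ₘ E) →
      ReducesToK2 (Finset.cons v S hv) (s(v, a) ::ₘ s(v, b) ::ₘ E)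

/-- A (finite, simple) graph is series-parallel if it can be turned into `K₂` by a sequence of
series and parallel reductions, carried out on multigraphs. -/
def IsSeriesParallel {V : Type*} [Fintype V] (G : SimpleGraph V) : Prop :=
  ReducesToK2 Finset.univ (Set.toFinite G.edgeSet).toFinset.val

/-- `A` is a simple arc in the plane `ℂ` with endpoints `x` and `y`. -/
def IsArc (A : Set ℂ) (x y : ℂ) : Prop :=
  ∃ γ : Path x y, Function.Injective γ ∧ Set.range γ = A

/-- A graph is outerplanar if it can be drawn in the plane without crossings so that all vertices lie
on the outer face, in the form: it can be drawn without crossings in a closed disc with all its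
vertices on the boundary circle. That is, the vertices are distinct points of the unit circle, each edge is a simple arc in the closed
unit disc joining its two ends and containing no other vertex, and the arcs of two distinct edges
meet at most in the common ends of these edges. -/
def IsOuterplanar {V : Type*} (G : SimpleGraph V) : Prop :=
  ∃ (p : V → ℂ) (A : Sym2 V → Set ℂ),
    Function.Injective p ∧
    (∀ v, p v ∈ Metric.sphere (0 : ℂ) 1) ∧
    (∀ u v, G.Adj u v → IsArc (A s(u, v)) (p u) (p v)) ∧
    (∀ e ∈ G.edgeSet, A e ⊆ Metric.closedBall (0 : ℂ) 1) ∧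
    (∀ e ∈ G.edgeSet, ∀ v, p v ∈ A e → v ∈ e) ∧
    (∀ e ∈ G.edgeSet, ∀ f ∈ G.edgeSet, e ≠ f → A e ∩ A f ⊆ p '' {v | v ∈ e ∧ v ∈ f})

/-- `IsEllTreeOn G l S`: the subgraph of `G` induced on `S` is an `l`-tree, i.e. it arises from a
complete graph on `l + 1` vertices by repeatedly adding a vertex `v` that has exactly `l` neighbors
among the vertices present, which together with `v` form a clique. -/
inductive IsEllTreeOn {V : Type*} (G : SimpleGraph V) (l : ℕ) : Finset V → Prop
  | base (S : Finset V) : G.IsNClique (l + 1) S → IsEllTreeOn G l S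
  | add (S T : Finset V) (v : V) (hv : v ∉ S) :
      IsEllTreeOn G l S → T ⊆ S → G.IsNClique l T → (∀ u ∈ S, G.Adj v u ↔ u ∈ T) →
      IsEllTreeOn G l (Finset.cons v S hv)

/-- `G` is an `l`-tree. -/
def IsEllTree {V : Type*} [Fintype V] (G : SimpleGraph V) (l : ℕ) : Prop :=
  IsEllTreeOn G l Finset.univ

end RobustColoring

/-!
All four bounds come from degeneracy. Suppose that the vertices of `G` can be listed so that each
has at most `d` neighbors among the earlier ones, and color them in this order. For each vertex at
least `k - d` colors are available, so some available color occurs on at most a fraction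
`1 / (k - d)` of the earlier `H`-neighbors; choosing it makes at most that fraction of the new
edges of `H` monochromatic. In total at most `|E(H)| / (k - d)` edges of `H` are monochromatic
(`IsDegenerateOn.exists_coloring`).

Trees are `1`-degenerate and `ℓ`-trees are `ℓ`-degenerate. A series-parallel graph is
`2`-degenerate because undoing a series reduction adds a vertex of degree two. An outerplanar graph
is `2`-degenerate as well, which needs a little topology. Two arcs in a closed disc whose ends
interleave on the boundary circle must meet (`exists_eq_of_interleaved`): otherwise the difference
of their parametrizations is a map from a square to `ℂ \ {0}`, hence has a continuous logarithm,
although its argument changes by a full turn around the boundary of the square. So the edges of an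
outerplanar graph behave like noncrossing chords, and the vertices under a shortest edge that spans
some vertex have degree at most two (`isDegenerateOn_of_noncrossing`).
-/

namespace RobustColoring

/-! ### Degenerate graphs and greedy coloring -/

/-- `IsDegenerateOn G d S`: the vertices of `S` can be listed so that each of them has at most `d`
neighbors among the vertices listed before it. The set `T` is any set of at most `d` vertices
containing these neighbors. -/
inductive IsDegenerateOn {V : Type*} (G : SimpleGraph V) (d : ℕ) : Finset V → Prop
  | empty : IsDegenerateOn G d ∅
  | cons (S T : Finset V) (v : V) (hv : v ∉ S) :
      IsDegenerateOn G d S → T.card ≤ d → (∀ u ∈ S, G.Adj v u → u ∈ T) →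
      IsDegenerateOn G d (Finset.cons v S hv)

open Classical in
/-- Removing vertices of small degree one after another gives a degenerate ordering. -/
theorem IsDegenerateOn.of_forall_exists {V : Type*} {G : SimpleGraph V} {d : ℕ} (S : Finset V)
    (h : ∀ S' ⊆ S, S'.Nonempty → ∃ v ∈ S', {u ∈ S' | G.Adj v u}.card ≤ d) :
    IsDegenerateOn G d S := by
  induction S using Finset.strongInduction with
  | H S ih =>
    rcases S.eq_empty_or_nonempty with rfl | hS
    · exact .empty
    obtain ⟨v, hv, hd⟩ := h S subset_rfl hS
    have h1 := IsDegenerateOn.cons (S.erase v) {u ∈ S | G.Adj v u} v (Finset.notMem_erase v S)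
      (ih _ (Finset.erase_ssubset hv) fun S' hS' ↦ h S' (hS'.trans (Finset.erase_subset v S))) hd
      (fun u hu huv ↦ Finset.mem_filter.2 ⟨Finset.mem_of_mem_erase hu, huv⟩)
    rwa [Finset.cons_eq_insert, Finset.insert_erase hv] at h1

/-- Among at least `m` available colors, some color is used at most `#N / m` times on `N`. -/
theorem exists_mul_card_fiber_le {V C : Type*} [DecidableEq C] (N : Finset V) (A : Finset C) (c : V → C) {m : ℕ}
    (hm : 0 < m) (hA : m ≤ A.card) :
    ∃ x ∈ A, m * {u ∈ N | c u = x}.card ≤ N.card := by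
  obtain ⟨x, hx, hmin⟩ := A.exists_min_image (fun x ↦ {u ∈ N | c u = x}.card)
    (Finset.card_pos.1 (hm.trans_le hA))
  refine ⟨x, hx, ?_⟩
  calc m * {u ∈ N | c u = x}.card ≤ A.card * {u ∈ N | c u = x}.card := by gcongr
    _ ≤ ∑ y ∈ A, {u ∈ N | c u = y}.card := by
      simpa using Finset.card_nsmul_le_sum A _ _ hmin
    _ = {u ∈ N | c u ∈ A}.card := by
      rw [Finset.card_eq_sum_card_fiberwise (f := c) (t := A) (by intro u; simp)]
      refine Finset.sum_congr rfl fun y hy ↦ ?_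
      rw [Finset.filter_filter]
      congr 1
      ext u
      simp only [Finset.mem_filter]
      grind
    _ ≤ N.card := Finset.card_filter_le _ _

open Classical in
/-- The greedy coloring: each new vertex receives an available color which creates the fewest
monochromatic edges of `E` to the vertices already colored. -/
theorem IsDegenerateOn.exists_coloring {V : Type*} {G : SimpleGraph V} {d k : ℕ} (hd : d < k)
    (E : Finset (Sym2 V)) (hE : ∀ e ∈ E, ¬ e.IsDiag) {S : Finset V}
    (h : IsDegenerateOn G d S) :
    ∃ c : V → Fin k, (∀ u ∈ S, ∀ v ∈ S, G.Adj u v → c u ≠ c v) ∧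
      (k - d) * {e ∈ E | e ∈ S.sym2 ∧ (e.map c).IsDiag}.card ≤ {e ∈ E | e ∈ S.sym2}.card := by
  induction h with
  | empty => exact ⟨fun _ ↦ ⟨0, by omega⟩, by simp, by simp⟩
  | cons S T v hv _ hT hTS ih =>
    obtain ⟨c, hc, hcard⟩ := ih
    obtain ⟨x, hx, hxN⟩ := exists_mul_card_fiber_le {u ∈ S | s(v, u) ∈ E}
      (T.image c)ᶜ c (m := k - d) (by omega) (by
        rw [Finset.card_compl, Fintype.card_fin]
        have := Finset.card_image_le (s := T) (f := c)
        omega)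
    have hxT : ∀ u ∈ T, c u ≠ x := by simpa using hx
    set N := {u ∈ S | s(v, u) ∈ E} with hN
    have hne : ∀ u ∈ S, u ≠ v := fun u hu h ↦ hv (h ▸ hu)
    have himg (M : Finset V) : (M.image fun u ↦ s(v, u)).card = M.card :=
      Finset.card_image_of_injective _ fun a b hab ↦ Sym2.congr_right.1 hab
    refine ⟨Function.update c v x, ?_, ?_⟩
    · intro a ha b hb hab
      rw [Finset.mem_cons] at ha hb
      rcases ha with rfl | ha <;> rcases hb with rfl | hb
      · exact absurd hab G.irrefl
      · rw [Function.update_self, Function.update_of_ne (hne b hb)]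
        exact (hxT b (hTS b hb hab)).symm
      · rw [Function.update_self, Function.update_of_ne (hne a ha)]
        exact hxT a (hTS a ha hab.symm)
      · rw [Function.update_of_ne (hne a ha), Function.update_of_ne (hne b hb)]
        exact hc a ha b hb hab
    · have hmono : {e ∈ E | e ∈ (Finset.cons v S hv).sym2 ∧
            (e.map (Function.update c v x)).IsDiag} ⊆
          {e ∈ E | e ∈ S.sym2 ∧ (e.map c).IsDiag} ∪
            {u ∈ N | c u = x}.image fun u ↦ s(v, u) := by
        intro e he
        induction e with | _ a b
        simp only [Finset.mem_filter, Finset.mk_mem_sym2_iff, Finset.mem_cons, Sym2.map_mk,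
          Sym2.mk_isDiag_iff] at he
        obtain ⟨heE, ⟨ha, hb⟩, hab⟩ := he
        have hdiag := hE _ heE
        simp only [Finset.mem_union, Finset.mem_filter, Finset.mk_mem_sym2_iff, Sym2.map_mk,
          Sym2.mk_isDiag_iff, Finset.mem_image, hN]
        rcases ha with rfl | ha <;> rcases hb with rfl | hb
        · simp at hdiag
        · rw [Function.update_self, Function.update_of_ne (hne b hb)] at hab
          exact .inr ⟨b, ⟨⟨hb, heE⟩, hab.symm⟩, rfl⟩
        · rw [Function.update_self, Function.update_of_ne (hne a ha)] at hab
          exact .inr ⟨a, ⟨⟨ha, by rwa [Sym2.eq_swap]⟩, hab⟩, Sym2.eq_swap⟩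
        · rw [Function.update_of_ne (hne a ha), Function.update_of_ne (hne b hb)] at hab
          exact .inl ⟨heE, ⟨ha, hb⟩, hab⟩
      have hall : {e ∈ E | e ∈ S.sym2} ∪ N.image (fun u ↦ s(v, u)) ⊆
          {e ∈ E | e ∈ (Finset.cons v S hv).sym2} := by
        intro e he
        induction e with | _ a b
        simp only [Finset.mem_union, Finset.mem_filter, Finset.mk_mem_sym2_iff,
          Finset.mem_image, hN] at he
        simp only [Finset.mem_filter, Finset.mk_mem_sym2_iff, Finset.mem_cons]
        rcases he with he | ⟨u, ⟨hu, huE⟩, he⟩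
        · exact ⟨he.1, .inr he.2.1, .inr he.2.2⟩
        · have h2 : s(a, b) ∈ (Finset.cons v S hv).sym2 := by
            rw [← he, Finset.mk_mem_sym2_iff]
            simp [hu]
          exact ⟨he ▸ huE, by simpa using h2⟩
      have hdisj : Disjoint {e ∈ E | e ∈ S.sym2} (N.image fun u ↦ s(v, u)) := by
        rw [Finset.disjoint_left]
        rintro e he he'
        obtain ⟨u, -, rfl⟩ := Finset.mem_image.1 he'
        exact hv (Finset.mk_mem_sym2_iff.1 (Finset.mem_filter.1 he).2).1
      have h1 := (Finset.card_le_card hmono).trans (Finset.card_union_le _ _)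
      have h2 := Finset.card_le_card hall
      rw [Finset.card_union_of_disjoint hdisj, himg] at h2
      rw [himg] at h1
      calc _ ≤ (k - d) * _ := Nat.mul_le_mul_left _ h1
        _ ≤ _ := by rw [mul_add]; exact (add_le_add hcard hxN).trans h2

/-- For `d < k` a `d`-degenerate graph satisfies the averaging bound with denominator `k - d`. -/
theorem IsDegenerateOn.robustNumber_le {V : Type*} [Fintype V] {G : SimpleGraph V} {d k : ℕ}
    (h : IsDegenerateOn G d Finset.univ) (hd : d < k) (H : Gᶜ.Subgraph) :
    (robustNumber G H k : ℝ) ≤ (H.edgeSet.ncard : ℝ) / ((k : ℝ) - (d : ℝ)) := by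
  classical
  obtain ⟨c, hc, hcard⟩ := h.exists_coloring hd H.edgeSet.toFinset (by
    intro e he
    exact Gᶜ.not_isDiag_of_mem_edgeSet (H.edgeSet_subset (Set.mem_toFinset.1 he)))
  let φ : G.Coloring (Fin k) :=
    SimpleGraph.Coloring.mk c fun {u v} huv ↦ hc u (Finset.mem_univ u) v (Finset.mem_univ v) huv
  have hle : robustNumber G H k ≤ monochromaticCount H φ := Nat.sInf_le ⟨φ, rfl⟩
  have hmono : monochromaticCount H φ =
      {e ∈ H.edgeSet.toFinset | e ∈ (Finset.univ : Finset V).sym2 ∧ (e.map c).IsDiag}.card := by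
    rw [monochromaticCount, ← Set.ncard_coe_finset]
    congr 1
    ext e
    simp only [Set.mem_ofPred_eq, Finset.mem_coe, Finset.mem_filter, Set.mem_toFinset,
      Finset.sym2_univ, Finset.mem_univ, true_and]
    rfl
  have hall : {e ∈ H.edgeSet.toFinset | e ∈ (Finset.univ : Finset V).sym2}.card =
      H.edgeSet.ncard := by
    rw [Set.ncard_eq_toFinset_card']
    simp
  rw [← hmono, hall] at hcard
  have hkd : (0 : ℝ) < (k : ℝ) - d := by
    rw [sub_pos]; exact_mod_cast hd
  rw [le_div_iff₀ hkd, ← Nat.cast_sub hd.le, mul_comm]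
  exact_mod_cast (Nat.mul_le_mul_left _ hle).trans hcard

/-! ### Trees, `ℓ`-trees and series-parallel graphs -/

/-- In a tree, a vertex of `S` farthest from a fixed root has at most one neighbor in `S`, namely
its predecessor on the path from the root. -/
theorem isDegenerateOn_of_isTree {V : Type*} {G : SimpleGraph V} (hG : G.IsTree)
    (S : Finset V) : IsDegenerateOn G 1 S := by
  classical
  refine .of_forall_exists S fun S' _ hS' ↦ ?_
  obtain ⟨r⟩ := hG.connected.nonempty
  obtain ⟨v, hv, hmax⟩ := S'.exists_max_image (fun v ↦ G.dist r v) hS'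
  obtain ⟨q, hq, hql⟩ := (hG.connected r v).exists_path_of_dist
  have key : ∀ u ∈ S', G.Adj v u → u = q.penultimate := by
    intro u hu huv
    obtain ⟨p, hp, hpl⟩ := (hG.connected r u).exists_path_of_dist
    refine hG.isAcyclic.eq_penultimate_of_adj_end hq huv ?_
    refine hG.isAcyclic.mem_support_of_ne_mem_support_of_adj_of_isPath hq hp huv fun hvp ↦ ?_
    have h := congrArg SimpleGraph.Walk.length (hG.isAcyclic.path_concat hq hp huv hvp)
    rw [SimpleGraph.Walk.length_concat] at h
    have := hmax u hu
    omega
  refine ⟨v, hv, Finset.card_le_one.2 fun a ha b hb ↦ ?_⟩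
  rw [Finset.mem_filter] at ha hb
  rw [key a ha.1 ha.2, key b hb.1 hb.2]

theorem IsEllTreeOn.isDegenerateOn {V : Type*} {G : SimpleGraph V} {l : ℕ} {S : Finset V}
    (h : IsEllTreeOn G l S) : IsDegenerateOn G l S := by
  classical
  induction h with
  | base S hS =>
    refine .of_forall_exists S fun S' hS' ⟨v, hv⟩ ↦ ⟨v, hv, ?_⟩
    have h1 : {u ∈ S' | G.Adj v u} ⊆ S.erase v := by
      intro u hu
      rw [Finset.mem_filter] at hu
      exact Finset.mem_erase.2 ⟨hu.2.ne', hS' hu.1⟩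
    have h2 := Finset.card_le_card h1
    rw [Finset.card_erase_of_mem (hS' hv), hS.card_eq] at h2
    simpa using h2
  | add S T v hv _ _ hT hadj ih =>
    exact .cons S T v hv ih hT.card_eq.le fun u hu ↦ (hadj u hu).1

/-- Reversing the reductions adds vertices of degree two: only the support of the edge multiset
matters, so parallel edges are harmless, and an edge `ab` created by a series reduction can only
increase degrees. -/
theorem ReducesToK2.isDegenerateOn {V : Type*} {S : Finset V} {E : Multiset (Sym2 V)}
    (h : ReducesToK2 S E) {G : SimpleGraph V}
    (hG : ∀ u ∈ S, ∀ v ∈ S, G.Adj u v → s(u, v) ∈ E) : IsDegenerateOn G 2 S := by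
  classical
  induction h with
  | base a b hab =>
    refine .of_forall_exists _ fun S' hS' ⟨v, hv⟩ ↦ ⟨v, hv, ?_⟩
    refine (Finset.card_filter_le _ _).trans ((Finset.card_le_card hS').trans ?_)
    simp only [Finset.card_cons, Finset.card_singleton, Nat.reduceAdd, le_refl]
  | parallel S e E _ ih =>
    refine ih fun u hu v hv huv ↦ ?_
    have := hG u hu v hv huv
    simp only [Multiset.mem_cons] at this ⊢
    tauto
  | series S v a b E hv ha hb hE _ ih =>
    refine .cons S {a, b} v hv (ih fun u hu w hw huw ↦ ?_) Finset.card_le_two fun u hu hvu ↦ ?_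
    · have := hG u (Finset.mem_cons_of_mem hu) w (Finset.mem_cons_of_mem hw) huw
      have hu' : u ≠ v := fun h ↦ hv (h ▸ hu)
      have hw' : w ≠ v := fun h ↦ hv (h ▸ hw)
      simp only [Multiset.mem_cons, Sym2.eq_iff] at this ⊢
      tauto
    · have := hG v (Finset.mem_cons_self v S) u (Finset.mem_cons_of_mem hu) hvu
      have hu' : u ≠ v := fun h ↦ hv (h ▸ hu)
      simp only [Multiset.mem_cons, Sym2.eq_iff] at this
      rw [Finset.mem_insert, Finset.mem_singleton]
      rcases this with h | h | h
      · grind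
      · grind
      · exact absurd (Sym2.mem_mk_left v u) (hE _ h)

theorem IsSeriesParallel.isDegenerateOn {V : Type*} [Fintype V] {G : SimpleGraph V}
    (h : IsSeriesParallel G) : IsDegenerateOn G 2 Finset.univ :=
  ReducesToK2.isDegenerateOn h fun u _ v _ huv ↦ by simpa using huv

/-! ### Noncrossing chords -/

/-- If the vertices are placed on a line so that no two edges interleave, then the graph is
`2`-degenerate. Below an edge spanning the fewest (but at least one) vertices of `S`, every vertex
of `S` is adjacent in `S` only to the vertices next to it. -/
theorem isDegenerateOn_of_noncrossing {V : Type*} {G : SimpleGraph V} (θ : V → ℝ)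
    (hθ : Function.Injective θ)
    (hnc : ∀ a b c d, G.Adj a b → G.Adj c d → θ a < θ c → θ c < θ b → θ b < θ d → False)
    (S : Finset V) : IsDegenerateOn G 2 S := by
  classical
  refine .of_forall_exists S fun S' _ hS' ↦ ?_
  by_contra! hcon
  let B (a b : V) : Finset V := {z ∈ S' | θ a < θ z ∧ θ z < θ b}
  -- A vertex with three neighbors has two on the same side, and the nearer one lies below the
  -- edge to the farther one.
  have hlong : ∀ w ∈ S', ∃ x ∈ S', G.Adj w x ∧ ((B w x).Nonempty ∨ (B x w).Nonempty) := by
    intro w hw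
    by_contra! hno
    have hup : {u ∈ S' | G.Adj w u ∧ θ w < θ u}.card ≤ 1 := by
      refine Finset.card_le_one.2 fun x hx y hy ↦ hθ ?_
      rw [Finset.mem_filter] at hx hy
      by_contra hxy
      rcases lt_or_gt_of_ne hxy with h | h
      · exact Finset.notMem_empty x ((hno y hy.1 hy.2.1).1 ▸
          Finset.mem_filter.2 ⟨hx.1, hx.2.2, h⟩)
      · exact Finset.notMem_empty y ((hno x hx.1 hx.2.1).1 ▸
          Finset.mem_filter.2 ⟨hy.1, hy.2.2, h⟩)
    have hdown : {u ∈ S' | G.Adj w u ∧ θ u < θ w}.card ≤ 1 := by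
      refine Finset.card_le_one.2 fun x hx y hy ↦ hθ ?_
      rw [Finset.mem_filter] at hx hy
      by_contra hxy
      rcases lt_or_gt_of_ne hxy with h | h
      · exact Finset.notMem_empty y ((hno x hx.1 hx.2.1).2 ▸
          Finset.mem_filter.2 ⟨hy.1, h, hy.2.2⟩)
      · exact Finset.notMem_empty x ((hno y hy.1 hy.2.1).2 ▸
          Finset.mem_filter.2 ⟨hx.1, h, hx.2.2⟩)
    have hsub : {u ∈ S' | G.Adj w u} ⊆
        {u ∈ S' | G.Adj w u ∧ θ w < θ u} ∪ {u ∈ S' | G.Adj w u ∧ θ u < θ w} := by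
      intro u hu
      rw [Finset.mem_filter] at hu
      rw [Finset.mem_union, Finset.mem_filter, Finset.mem_filter]
      rcases lt_or_gt_of_ne (hθ.ne hu.2.ne) with h | h
      · exact .inl ⟨hu.1, hu.2, h⟩
      · exact .inr ⟨hu.1, hu.2, h⟩
    have h1 := (Finset.card_le_card hsub).trans (Finset.card_union_le _ _)
    have h2 := hcon w hw
    omega
  let P : Finset (V × V) := {e ∈ S' ×ˢ S' | G.Adj e.1 e.2 ∧ (B e.1 e.2).Nonempty}
  have hP : P.Nonempty := by
    obtain ⟨w, hw⟩ := hS'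
    obtain ⟨x, hx, hwx, h | h⟩ := hlong w hw
    · exact ⟨(w, x), by simp [P, hw, hx, hwx, h]⟩
    · exact ⟨(x, w), by simp [P, hw, hx, hwx.symm, h]⟩
  obtain ⟨⟨u, v⟩, huv, hmin⟩ := P.exists_min_image (fun e ↦ (B e.1 e.2).card) hP
  simp only [P, Finset.mem_filter, Finset.mem_product, and_imp, Prod.forall] at huv hmin
  obtain ⟨⟨hu, hv⟩, hadj, w, hwB⟩ := huv
  obtain ⟨hw, huw, hwv⟩ := Finset.mem_filter.1 hwB
  obtain ⟨x, hx, hwx, hB⟩ := hlong w hw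
  have hux : θ u ≤ θ x := by
    by_contra! h
    exact hnc x w u v hwx.symm hadj h huw hwv
  have hxv : θ x ≤ θ v := by
    by_contra! h
    exact hnc u v w x hadj hwx huw hwv h
  rcases hB with hB | hB
  · refine (hmin w x hw hx hwx hB).not_gt (Finset.card_lt_card
      ((Finset.ssubset_iff_of_subset fun z hz ↦ ?_).2 ⟨w, hwB, by simp [B]⟩))
    obtain ⟨hz, h1, h2⟩ := Finset.mem_filter.1 hz
    exact Finset.mem_filter.2 ⟨hz, huw.trans h1, h2.trans_le hxv⟩
  · refine (hmin x w hx hw hwx.symm hB).not_gt (Finset.card_lt_card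
      ((Finset.ssubset_iff_of_subset fun z hz ↦ ?_).2 ⟨w, hwB, by simp [B]⟩))
    obtain ⟨hz, h1, h2⟩ := Finset.mem_filter.1 hz
    exact Finset.mem_filter.2 ⟨hz, hux.trans_lt h1, h2.trans hwv⟩

/-! ### Arcs in a disc with interleaved ends -/

/-- Two continuous logarithms of `w * h` along a segment have the same increment when `h` stays in
the slit plane, namely that of the principal logarithm of `h`. -/
theorem sub_eq_log_sub_log_of_exp_eq {L h : ℝ → ℂ} {w : ℂ} (hL : Continuous L)
    (hh : Continuous h) (hslit : ∀ s, h s ∈ Complex.slitPlane)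
    (he : ∀ s, Complex.exp (L s) = w * h s) :
    L 1 - L 0 = Complex.log (h 1) - Complex.log (h 0) := by
  have hw : ∀ s, Complex.exp (L s - Complex.log (h s)) = w := by
    intro s
    have h0 := Complex.slitPlane_ne_zero (hslit s)
    rw [Complex.exp_sub, he, Complex.exp_log h0, mul_div_assoc, div_self h0, mul_one]
  have := Complex.isCoveringMap_exp.const_of_comp (A := ℝ)
    (g := fun s ↦ L s - Complex.log (h s)) (hL.sub (hh.clog hslit))
    (fun a a' ↦ Subtype.ext ((hw a).trans (hw a').symm)) 1 0
  linear_combination this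

theorem one_sub_mem_slitPlane_of_norm_le {z : ℂ} (hz : ‖z‖ ≤ 1) (hz1 : z ≠ 1) :
    1 - z ∈ Complex.slitPlane := by
  refine .inl ?_
  have hre : z.re ≤ 1 := (Complex.re_le_norm z).trans hz
  rw [Complex.sub_re, Complex.one_re, sub_pos]
  refine hre.lt_of_ne fun h ↦ hz1 (Complex.ext h ?_)
  have h1 : ‖z‖ ^ 2 ≤ 1 := by nlinarith [norm_nonneg z]
  rw [← Complex.normSq_eq_norm_sq, Complex.normSq_apply, h] at h1
  rw [Complex.one_im]
  nlinarith [sq_nonneg z.im]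

theorem arg_one_sub_exp_of_pos {x : ℝ} (h0 : 0 < x) (h2 : x < 2 * Real.pi) :
    (1 - Complex.exp (x * Complex.I)).arg = (x - Real.pi) / 2 := by
  have hs : 0 < 2 * Real.sin (x / 2) :=
    mul_pos two_pos (Real.sin_pos_of_pos_of_lt_pi (by linarith) (by linarith))
  rw [← Complex.arg_mul_cos_add_sin_mul_I hs (θ := (x - Real.pi) / 2)
    ⟨by linarith, by linarith⟩]
  congr 1
  have e1 : Real.cos ((x - Real.pi) / 2) = Real.sin (x / 2) := by
    rw [← Real.cos_sub_pi_div_two]; ring_nf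
  have e2 : Real.sin ((x - Real.pi) / 2) = - Real.cos (x / 2) := by
    rw [← Real.sin_sub_pi_div_two]; ring_nf
  have c1 : Real.cos x = 1 - 2 * Real.sin (x / 2) ^ 2 := by
    have h := Real.cos_two_mul (x / 2)
    rw [mul_div_cancel₀ x two_ne_zero] at h
    linarith [Real.sin_sq_add_cos_sq (x / 2)]
  have c2 : Real.sin x = 2 * Real.sin (x / 2) * Real.cos (x / 2) := by
    rw [← Real.sin_two_mul, mul_div_cancel₀ x two_ne_zero]
  rw [← Complex.ofReal_cos, ← Complex.ofReal_sin, e1, e2, Complex.exp_mul_I,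
    ← Complex.ofReal_cos, ← Complex.ofReal_sin, c1, c2]
  push_cast
  ring

theorem arg_one_sub_exp_of_neg {x : ℝ} (h0 : x < 0) (h2 : -(2 * Real.pi) < x) :
    (1 - Complex.exp (x * Complex.I)).arg = (x + Real.pi) / 2 := by
  have h := arg_one_sub_exp_of_pos (x := x + 2 * Real.pi) (by linarith) (by linarith)
  rw [Complex.ofReal_add, add_mul] at h
  push_cast at h
  rw [Complex.exp_periodic] at h
  rw [h]
  ring

/-- The increment of a continuous logarithm of `η - c` along a path `η` in the closed unit disc
which avoids the boundary point `c`: the path `η - c` stays in an open half-plane. -/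
theorem im_sub_of_exp_eq_mul_sub {L η : ℝ → ℂ} {w : ℂ} {x y t : ℝ} (hL : Continuous L)
    (hη : Continuous η) (hdisc : ∀ s, ‖η s‖ ≤ 1) (h0 : η 0 = Complex.exp (x * Complex.I))
    (h1 : η 1 = Complex.exp (y * Complex.I)) (hne : ∀ s, η s ≠ Complex.exp (t * Complex.I))
    (he : ∀ s, Complex.exp (L s) = w * (η s - Complex.exp (t * Complex.I))) :
    (L 1).im - (L 0).im =
      (1 - Complex.exp (((y - t : ℝ) : ℂ) * Complex.I)).arg -
        (1 - Complex.exp (((x - t : ℝ) : ℂ) * Complex.I)).arg := by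
  have hrot : Complex.exp (t * Complex.I) * Complex.exp (-(t * Complex.I)) = 1 := by
    rw [← Complex.exp_add, add_neg_cancel, Complex.exp_zero]
  have hnorm : ‖Complex.exp (-(t * Complex.I))‖ = 1 := by
    rw [← neg_mul, ← Complex.ofReal_neg, Complex.norm_exp_ofReal_mul_I]
  have key := sub_eq_log_sub_log_of_exp_eq (L := L)
    (h := fun s ↦ 1 - η s * Complex.exp (-(t * Complex.I)))
    (w := - w * Complex.exp (t * Complex.I)) hL (by fun_prop) (fun s ↦ by
      refine one_sub_mem_slitPlane_of_norm_le (by rw [norm_mul, hnorm, mul_one]; exact hdisc s) ?_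
      intro h
      apply hne s
      linear_combination Complex.exp (t * Complex.I) * h - η s * hrot)
    (fun s ↦ by rw [he]; linear_combination - w * η s * hrot)
  have e (z : ℝ) : Complex.exp (z * Complex.I) * Complex.exp (-(t * Complex.I)) =
      Complex.exp (((z - t : ℝ) : ℂ) * Complex.I) := by
    rw [← Complex.exp_add]; push_cast; ring_nf
  have := congrArg Complex.im key
  simpa only [Complex.sub_im, Complex.log_im, h0, h1, e] using this

/-- Two paths in the closed unit disc whose ends interleave on the unit circle meet, provided each
avoids the ends of the other. Otherwise `γ s - δ t` would have a continuous logarithm on the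
plane of all `(s, t)`, but around the boundary of the unit square its argument changes by a full
turn. -/
theorem exists_eq_of_interleaved {a b c d : ℝ} (hac : a < c) (hcb : c < b) (hbd : b < d)
    (hda : d < a + 2 * Real.pi) (γ δ : C(ℝ, ℂ))
    (hγ : ∀ s, ‖γ s‖ ≤ 1) (hδ : ∀ t, ‖δ t‖ ≤ 1)
    (hγ0 : γ 0 = Complex.exp (a * Complex.I)) (hγ1 : γ 1 = Complex.exp (b * Complex.I))
    (hδ0 : δ 0 = Complex.exp (c * Complex.I)) (hδ1 : δ 1 = Complex.exp (d * Complex.I)) :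
    ∃ s t, γ s = δ t := by
  by_contra! hne
  obtain ⟨L, hL, hexp⟩ := Complex.exists_continuousOn_eqOn_exp_comp (X := ℝ × ℝ)
    (U := Set.univ) (g := fun z ↦ γ z.1 - δ z.2)
    (Homeomorph.Set.univ (ℝ × ℝ)).toHomotopyEquiv.simplyConnectedSpace
    isOpen_univ (by fun_prop) (by
      rintro ⟨z, -, hz⟩
      exact hne _ _ (sub_eq_zero.1 hz))
  rw [continuousOn_univ] at hL
  replace hexp : ∀ s t, Complex.exp (L (s, t)) = γ s - δ t :=
    fun s t ↦ hexp (Set.mem_univ (s, t))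
  have bottom := im_sub_of_exp_eq_mul_sub (L := fun s ↦ L (s, 0)) (η := γ) (w := 1) (t := c)
    (by fun_prop) (by fun_prop) hγ hγ0 hγ1 (fun s ↦ hδ0 ▸ hne s 0)
    (fun s ↦ by rw [hexp, hδ0, one_mul])
  have top := im_sub_of_exp_eq_mul_sub (L := fun s ↦ L (s, 1)) (η := γ) (w := 1) (t := d)
    (by fun_prop) (by fun_prop) hγ hγ0 hγ1 (fun s ↦ hδ1 ▸ hne s 1)
    (fun s ↦ by rw [hexp, hδ1, one_mul])
  have left := im_sub_of_exp_eq_mul_sub (L := fun t ↦ L (0, t)) (η := δ) (w := -1) (t := a)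
    (by fun_prop) (by fun_prop) hδ hδ0 hδ1 (fun t ↦ hγ0 ▸ (hne 0 t).symm)
    (fun t ↦ by rw [hexp, hγ0]; ring)
  have right := im_sub_of_exp_eq_mul_sub (L := fun t ↦ L (1, t)) (η := δ) (w := -1) (t := b)
    (by fun_prop) (by fun_prop) hδ hδ0 hδ1 (fun t ↦ hγ1 ▸ (hne 1 t).symm)
    (fun t ↦ by rw [hexp, hγ1]; ring)
  rw [arg_one_sub_exp_of_pos (by linarith) (by linarith),
    arg_one_sub_exp_of_neg (by linarith) (by linarith)] at bottom
  rw [arg_one_sub_exp_of_neg (by linarith) (by linarith),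
    arg_one_sub_exp_of_neg (by linarith) (by linarith)] at top
  rw [arg_one_sub_exp_of_pos (by linarith) (by linarith),
    arg_one_sub_exp_of_pos (by linarith) (by linarith)] at left
  rw [arg_one_sub_exp_of_pos (by linarith) (by linarith),
    arg_one_sub_exp_of_neg (by linarith) (by linarith)] at right
  -- `bottom + right - top - left` telescopes to `0` for `L`, and to `-2 * π` for the arguments.
  linarith [Real.pi_pos]

/-- Placing the vertices of an outerplanar drawing on a line by their arguments, no two edges
interleave. -/
theorem IsOuterplanar.isDegenerateOn {V : Type*} {G : SimpleGraph V} (h : IsOuterplanar G)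
    (S : Finset V) : IsDegenerateOn G 2 S := by
  obtain ⟨p, A, hp, hcirc, harc, hdisc, -, hcross⟩ := h
  have hexp (v : V) : Complex.exp ((p v).arg * Complex.I) = p v := by
    have := Complex.norm_mul_exp_arg_mul_I (p v)
    rwa [mem_sphere_zero_iff_norm.1 (hcirc v), Complex.ofReal_one, one_mul] at this
  refine isDegenerateOn_of_noncrossing (fun v ↦ (p v).arg)
    (fun u v huv ↦ hp (by rw [← hexp u, ← hexp v]; exact congrArg _ (by simp_all))) ?_ S
  intro a b c d hab hcd hac hcb hbd
  obtain ⟨γ, -, hγ⟩ := harc a b hab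
  obtain ⟨δ, -, hδ⟩ := harc c d hcd
  have hγA (s : ℝ) : γ.extend s ∈ A s(a, b) := by
    rw [← hγ, ← Path.extend_range]; exact Set.mem_range_self s
  have hδA (s : ℝ) : δ.extend s ∈ A s(c, d) := by
    rw [← hδ, ← Path.extend_range]; exact Set.mem_range_self s
  obtain ⟨s, t, hst⟩ := exists_eq_of_interleaved hac hcb hbd
    (by linarith [(p d).arg_le_pi, (p a).neg_pi_lt_arg]) ⟨γ.extend, γ.continuous_extend⟩
    ⟨δ.extend, δ.continuous_extend⟩
    (fun s ↦ mem_closedBall_zero_iff.1 (hdisc _ hab (hγA s)))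
    (fun s ↦ mem_closedBall_zero_iff.1 (hdisc _ hcd (hδA s)))
    (by simp [hexp]) (by simp [hexp]) (by simp [hexp]) (by simp [hexp])
  have hne : ∀ v, v ∈ s(a, b) → v ∉ s(c, d) := by
    intro v hv hv'
    rw [Sym2.mem_iff] at hv hv'
    rcases hv with rfl | rfl <;> rcases hv' with h | h <;> subst h <;> linarith
  have hd : s(a, b) ≠ s(c, d) := fun h ↦ hne a (Sym2.mem_mk_left a b) (h ▸ Sym2.mem_mk_left a b)
  obtain ⟨v, ⟨hv, hv'⟩, -⟩ := hcross _ hab _ hcd hd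
    ⟨hγA s, by rw [show γ.extend s = δ.extend t from hst]; exact hδA t⟩
  exact hne v hv hv'

end RobustColoring

theorem mainTheorem11 {V : Type*} [Fintype V] (G : SimpleGraph V) (H : Gᶜ.Subgraph) (k : ℕ)
    (hk : G.chromaticNumber ≤ (k : ℕ∞)) :
    (G.IsTree → 1 < k →
      (RobustColoring.robustNumber G H k : ℝ) ≤ (H.edgeSet.ncard : ℝ) / ((k : ℝ) - 1)) ∧
    (RobustColoring.IsSeriesParallel G → G.chromaticNumber = 3 →
      (RobustColoring.robustNumber G H k : ℝ) ≤ (H.edgeSet.ncard : ℝ) / ((k : ℝ) - 2)) ∧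
    (G.IsBipartite → RobustColoring.IsOuterplanar G → 2 < k →
      (RobustColoring.robustNumber G H k : ℝ) ≤ (H.edgeSet.ncard : ℝ) / ((k : ℝ) - 2)) ∧
    (∀ l : ℕ, RobustColoring.IsEllTree G l → G.chromaticNumber = ((l + 1 : ℕ) : ℕ∞) →
      (RobustColoring.robustNumber G H k : ℝ) ≤ (H.edgeSet.ncard : ℝ) / ((k : ℝ) - (l : ℝ))) := by
  refine ⟨fun hG h1 ↦ ?_, fun hG h3 ↦ ?_, fun _ hG h2 ↦ ?_, fun l hG hl ↦ ?_⟩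
  · exact_mod_cast (RobustColoring.isDegenerateOn_of_isTree hG _).robustNumber_le h1 H
  · rw [h3] at hk
    have hk3 : 3 ≤ k := by exact_mod_cast hk
    exact_mod_cast hG.isDegenerateOn.robustNumber_le (by omega : 2 < k) H
  · exact_mod_cast (hG.isDegenerateOn Finset.univ).robustNumber_le h2 H
  · rw [hl] at hk
    have hkl : l + 1 ≤ k := by exact_mod_cast hk
    exact (RobustColoring.IsEllTreeOn.isDegenerateOn hG).robustNumber_le hkl H
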